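/- Let $0<m<n$, let $f:\mathbb R^n\to\mathbb R^m$ be smooth ($C^\infty$), and suppose that its Jacobian $J(x)$ has full rank $m$ at every $x\in\mathbb R^n$. Let $H(x)[\cdot,\cdot]$ be the second derivative of $f$ at $x$, and let $H(x)[w,\cdot]$ be the linear map $z\mapsto H(x)[w,z]$. Put $$J(x)^+=J(x)^\top\big(J(x)J(x)^\top\big)^{-1},\quad N(x)=J(x)^+J(x),\quad T(x)=I-N(x),\quad R(x)=I-2N(x),$$ $$N'_\perp(x)[w]=J(x)^+\,H(x)[w,\cdot]\,T(x),\qquad N'_\|(x)[w]=\big(N'_\perp(x)[w]\big)^\top .$$ Fix $x_0,v_0\in\mathbb R^n$ and a time interval $[0,\tau]$, $\tau\ge 0$, and let $(x(t),v(t))$, $0\le t\le\tau$, be the solution of $$\dot x=T(x)v,\qquad \dot v=\Big(N'_\|(x)\big[(T(x)-N(x))v\big]-N'_\perp(x)\big[(T(x)-N(x))v\big]\Big)v$$ with $x(0)=x_0$, $v(0)=v_0$. Write $v_\|(t)=T(x(t))v(t)$ and $v_\perp(t)=N(x(t))v(t)$. For a step length $\delta>0$ let the Hug iterates $(x_k,v_k)$,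 started at $(x_0,v_0)$, be given by $$x_{k+1/2}=x_k+\tfrac{\delta}{2}v_k,\qquad v_{k+1}=R(x_{k+1/2})v_k,\qquad x_{k+1}=x_{k+1/2}+\tfrac{\delta}{2}v_{k+1}.$$ Then, as $\delta\to0^+$, $$\max_{k\delta\le \tau}\|x_k-x(k\delta)\|=\mathcal O(\delta^2),\qquad \max_{k\delta\le \tau}\big\|v_k-\big(v_\|(k\delta)+(-1)^kv_\perp(k\delta)\big)\big\|=\mathcal O(\delta^2),$$ where the constants implicit in the $\mathcal O$ notation depend only on $f$, $x_0$, $v_0$ and $\tau$. -/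

import Mathlib

open scoped ContDiff

noncomputable section

namespace Hug

/-- Euclidean space `ℝⁿ`. -/
abbrev E (n : ℕ) : Type := EuclideanSpace ℝ (Fin n)

variable {n m : ℕ}

/-- The Jacobian `J(x)` of `f : ℝⁿ → ℝᵐ`, as a linear map `ℝⁿ → ℝᵐ`. -/
def J (f : E n → E m) (x : E n) : E n →L[ℝ] E m :=
  fderiv ℝ f x

/-- The second derivative: `H f x w` is the linear map `z ↦ H(x)[w, z]`. -/
def H (f : E n → E m) (x w : E n) : E n →L[ℝ] E m :=
  fderiv ℝ (fderiv ℝ f) x w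

/-- The Moore-Penrose inverse `J(x)⁺ = J(x)ᵀ (J(x) J(x)ᵀ)⁻¹` (for `J(x)` of rank `m`). -/
def Jplus (f : E n → E m) (x : E n) : E m →L[ℝ] E n :=
  (J f x).adjoint ∘L (J f x ∘L (J f x).adjoint).inverse

/-- `N(x) = J(x)⁺ J(x)`, the orthogonal projection onto the normal space at `x`. -/
def N (f : E n → E m) (x : E n) : E n →L[ℝ] E n :=
  Jplus f x ∘L J f x

/-- `T(x) = I - N(x)`, the orthogonal projection onto the tangent space `ker J(x)`. -/
def T (f : E n → E m) (x : E n) : E n →L[ℝ] E n :=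
  ContinuousLinearMap.id ℝ (E n) - N f x

/-- `R(x) = I - 2 N(x)`, the reflection with respect to the tangent space at `x`. -/
def R (f : E n → E m) (x : E n) : E n →L[ℝ] E n :=
  ContinuousLinearMap.id ℝ (E n) - (2 : ℝ) • N f x

/-- `N'_⊥(x)[w] = J(x)⁺ H(x)[w, ·] T(x)`. -/
def Nperp' (f : E n → E m) (x w : E n) : E n →L[ℝ] E n :=
  Jplus f x ∘L H f x w ∘L T f x

/-- `N'_∥(x)[w]`, the transpose of `N'_⊥(x)[w]`. -/
def Npar' (f : E n → E m) (x w : E n) : E n →L[ℝ] E n :=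
  (Nperp' f x w).adjoint

/-- One Hug step of length `δ`, sending `(x_k, v_k)` to `(x_{k+1}, v_{k+1})`:
`x_{k+1/2} = x_k + (δ/2) v_k`, `v_{k+1} = R(x_{k+1/2}) v_k`,
`x_{k+1} = x_{k+1/2} + (δ/2) v_{k+1}`. -/
def step (f : E n → E m) (δ : ℝ) (p : E n × E n) : E n × E n :=
  let xhalf := p.1 + (δ / 2) • p.2
  let vnew := R f xhalf p.2
  (xhalf + (δ / 2) • vnew, vnew)

/-- The Hug iterates `(x_k, v_k)` with step length `δ` started at `(x₀, v₀)`. -/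
def iter (f : E n → E m) (δ : ℝ) (x₀ v₀ : E n) : ℕ → E n × E n
  | 0 => (x₀, v₀)
  | k + 1 => step f δ (iter f δ x₀ v₀ k)

/-- `(x(t), v(t))` solves on `[0, τ]` the system `x' = T(x) v`,
`v' = (N'_∥(x)[(T(x) - N(x)) v] - N'_⊥(x)[(T(x) - N(x)) v]) v`
(with one-sided derivatives at the end points). -/
structure IsSolution (f : E n → E m) (τ : ℝ) (x v : ℝ → E n) : Prop where
  deriv_x : ∀ t ∈ Set.Icc 0 τ, HasDerivWithinAt x (T f (x t) (v t)) (Set.Icc 0 τ) t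
  deriv_v : ∀ t ∈ Set.Icc 0 τ, HasDerivWithinAt v
    ((Npar' f (x t) ((T f (x t) - N f (x t)) (v t))
      - Nperp' f (x t) ((T f (x t) - N f (x t)) (v t))) (v t)) (Set.Icc 0 τ) t

end Hug

end

/-! Write `z = (x, v)`. Odd Hug velocities have the sign of their normal part flipped, so they are
compared with the smooth solution only after `reflect`. The reflected step `Φ h = reflect ∘ step h`
is the identity at `h = 0`, and its `h`-derivative there is the right-hand side F of the
differential equation (`hasDerivAt_reflect_step`): it is a consistent one-step method.

Since `step h ∘ step (-h) = id` and `reflect` is an involution, `Ψ h = step h ∘ reflect` inverts `Φ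
(-h)`, so Ψ is the adjoint method of Φ. Two Hug steps are `Ψ δ ∘ Φ δ`, the composition of a first
order method with its adjoint, hence of second order (`exists_second_order_bound`).

The local error is read off from `g h = Φ (h, z (s - h))` with `s = t + δ`. Here `g' 0 = F - F = 0`,
so the symmetric difference `g δ - g (-δ)` is `O(δ³)`; applying `Ψ δ` turns it into the error of a
double step from time t to `t + 2δ`. Stability and a discrete Gronwall argument give `O(δ²)`
globally. Conservation of `‖v‖` by both the flow and the iteration keeps everything in one compact
convex set, so the constants are uniform. -/

namespace Hug

/-! ### Second order convergence of a one-step method composed with its adjoint. -/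

section AdjointComposition

variable {V : Type*} [NormedAddCommGroup V] [NormedSpace ℝ V]

/-- The derivative of `h ↦ P (h, z (s - h))` along solutions of `z' = F z`. -/
noncomputable def backwardDeriv (F : V → V) (P : ℝ × V → V) (p : ℝ × V) : V :=
  fderiv ℝ P p (1, -F p.2)

lemma contDiff_backwardDeriv {F : V → V} {P : ℝ × V → V} (hF : ContDiff ℝ ∞ F)
    (hP : ContDiff ℝ ∞ P) : ContDiff ℝ ∞ (backwardDeriv F P) :=
  (hP.fderiv_right (m := ∞) le_rfl).clm_apply
    (contDiff_const.prodMk (hF.comp contDiff_snd).neg)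

/-- Iterating `backwardDeriv` yields all higher derivatives as fixed continuous functions of `(h,
z)`, so compactness bounds them independently of the solution. -/
lemma hasDerivWithinAt_comp_backward {F : V → V} {P : ℝ × V → V} (hP : ContDiff ℝ ∞ P)
    {z : ℝ → V} {A I : Set ℝ} (hz : ∀ t ∈ A, HasDerivWithinAt z (F (z t)) A t) {s : ℝ}
    (hI : ∀ h ∈ I, s - h ∈ A) {h : ℝ} (hh : h ∈ I) :
    HasDerivWithinAt (fun h => P (h, z (s - h))) (backwardDeriv F P (h, z (s - h))) I h := by
  have h1 : HasDerivWithinAt (fun h : ℝ => s - h) (-1) I h := by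
    simpa using (hasDerivWithinAt_id h I).const_sub s
  have h2 := (hz _ (hI h hh)).scomp h h1 hI
  have h3 : HasDerivWithinAt (fun h => (h, z (s - h))) ((1 : ℝ), -F (z (s - h))) I h := by
    simpa using (hasDerivWithinAt_id h I).prodMk h2
  have h4 := ((hP.differentiable (by simp)) (h, z (s - h))).hasFDerivAt
  exact h4.comp_hasDerivWithinAt h h3

lemma norm_le_mul_of_hasDerivWithinAt {g g' : ℝ → V} {δ M h : ℝ}
    (hg : ∀ r ∈ Set.Icc 0 δ, HasDerivWithinAt g (g' r) (Set.Icc 0 δ) r) (hh : h ∈ Set.Icc 0 δ)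
    (hM : ∀ r ∈ Set.Icc 0 h, ‖g' r‖ ≤ M) : ‖g h - g 0‖ ≤ M * h := by
  have hsub : Set.Icc 0 h ⊆ Set.Icc 0 δ := Set.Icc_subset_Icc_right hh.2
  have := (convex_Icc (0 : ℝ) h).norm_image_sub_le_of_norm_hasDerivWithin_le
    (fun r hr => (hg r (hsub hr)).mono hsub) hM (Set.left_mem_Icc.2 hh.1) (Set.right_mem_Icc.2 hh.1)
  simpa [abs_of_nonneg hh.1] using this

lemma norm_sub_le_sq {g g₁ g₂ : ℝ → V} {δ M : ℝ} (hδ : 0 ≤ δ)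
    (hg : ∀ r ∈ Set.Icc 0 δ, HasDerivWithinAt g (g₁ r) (Set.Icc 0 δ) r)
    (hg₁ : ∀ r ∈ Set.Icc 0 δ, HasDerivWithinAt g₁ (g₂ r) (Set.Icc 0 δ) r)
    (h0 : g₁ 0 = 0) (hM : ∀ r ∈ Set.Icc 0 δ, ‖g₂ r‖ ≤ M) : ‖g δ - g 0‖ ≤ M * δ ^ 2 := by
  have hM0 : 0 ≤ M := (norm_nonneg _).trans (hM 0 (Set.left_mem_Icc.2 hδ))
  have hB : ∀ r ∈ Set.Icc 0 δ, ‖g₁ r‖ ≤ M * δ := fun r hr => by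
    have := norm_le_mul_of_hasDerivWithinAt hg₁ hr
      (fun q hq => hM q ⟨hq.1, hq.2.trans hr.2⟩)
    rw [h0, sub_zero] at this
    exact this.trans (mul_le_mul_of_nonneg_left hr.2 hM0)
  have := norm_le_mul_of_hasDerivWithinAt hg (Set.right_mem_Icc.2 hδ) hB
  calc _ ≤ _ := this
    _ = _ := by ring

/-- The symmetric difference of a function with `g'(0) = 0` is of third order. -/
lemma norm_sub_neg_le_cube {g g₁ g₂ g₃ : ℝ → V} {δ M : ℝ} (hδ : 0 ≤ δ)
    (hg : ∀ r ∈ Set.Icc (-δ) δ, HasDerivWithinAt g (g₁ r) (Set.Icc (-δ) δ) r)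
    (hg₁ : ∀ r ∈ Set.Icc (-δ) δ, HasDerivWithinAt g₁ (g₂ r) (Set.Icc (-δ) δ) r)
    (hg₂ : ∀ r ∈ Set.Icc (-δ) δ, HasDerivWithinAt g₂ (g₃ r) (Set.Icc (-δ) δ) r)
    (h0 : g₁ 0 = 0) (hM : ∀ r ∈ Set.Icc (-δ) δ, ‖g₃ r‖ ≤ M) :
    ‖g δ - g (-δ)‖ ≤ 2 * M * δ ^ 3 := by
  have hpos : Set.Icc 0 δ ⊆ Set.Icc (-δ) δ := Set.Icc_subset_Icc_left (by linarith)
  have hneg : ∀ r ∈ Set.Icc 0 δ, -r ∈ Set.Icc (-δ) δ := fun r hr =>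
    ⟨by linarith [hr.2], by linarith [hr.1]⟩
  have key : ∀ {p q : ℝ → V},
      (∀ r ∈ Set.Icc (-δ) δ, HasDerivWithinAt p (q r) (Set.Icc (-δ) δ) r) →
      ∀ r ∈ Set.Icc 0 δ, HasDerivWithinAt (fun r => p (-r)) (-q (-r)) (Set.Icc 0 δ) r := by
    intro p q hpq r hr
    have h1 : HasDerivWithinAt (fun r : ℝ => -r) (-1) (Set.Icc 0 δ) r :=
      (hasDerivWithinAt_id r _).neg
    simpa [Function.comp_def] using (hpq _ (hneg r hr)).scomp r h1 hneg
  have hM0 : 0 ≤ M := (norm_nonneg _).trans (hM 0 ⟨by linarith, hδ⟩)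
  have h2 : ∀ r ∈ Set.Icc 0 δ, ‖g₂ r - g₂ (-r)‖ ≤ 2 * M * δ := fun r hr => by
    have := norm_le_mul_of_hasDerivWithinAt (M := 2 * M)
      (fun r hr => ((hg₂ r (hpos hr)).mono hpos).sub (key hg₂ r hr)) hr (fun q hq => by
        have hq' : q ∈ Set.Icc 0 δ := ⟨hq.1, hq.2.trans hr.2⟩
        calc _ ≤ ‖g₃ q‖ + ‖-g₃ (-q)‖ := norm_sub_le _ _
          _ ≤ 2 * M := by
            rw [norm_neg]; linarith [hM q (hpos hq'), hM _ (hneg q hq')])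
    have h' : ‖g₂ r - g₂ (-r)‖ ≤ 2 * M * r := by simpa using this
    exact h'.trans (mul_le_mul_of_nonneg_left hr.2 (by linarith))
  -- The odd difference has second derivative `g₂ r - g₂ (-r)`, itself of size `O(δ)`; this supplies
  -- the third power.
  have h1 := norm_sub_le_sq (g := fun r => g r - g (-r)) (g₁ := fun r => g₁ r + g₁ (-r))
    (g₂ := fun r => g₂ r - g₂ (-r)) hδ
    (fun r hr => by
      simpa only [sub_neg_eq_add] using ((hg r (hpos hr)).mono hpos).fun_sub (key hg r hr))
    (fun r hr => by
      simpa only [sub_eq_add_neg] using ((hg₁ r (hpos hr)).mono hpos).fun_add (key hg₁ r hr))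
    (by simp [h0]) h2
  calc _ ≤ 2 * M * δ * δ ^ 2 := by simpa using h1
    _ = _ := by ring

lemma exists_lipschitz_of_contDiff {W X : Type*} [NormedAddCommGroup W] [NormedSpace ℝ W]
    [NormedAddCommGroup X] [NormedSpace ℝ X] {g : W → X}
    (hg : ContDiff ℝ ∞ g) {K : Set W} (hK : IsCompact K) (hc : Convex ℝ K) :
    ∃ L : ℝ, 0 ≤ L ∧ ∀ p ∈ K, ∀ q ∈ K, ‖g p - g q‖ ≤ L * ‖p - q‖ := by
  obtain ⟨L, hL⟩ := hK.exists_bound_of_continuousOn (f := fderiv ℝ g)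
    (hg.continuous_fderiv (by simp)).continuousOn
  refine ⟨max L 0, le_max_right _ _, fun p hp q hq => ?_⟩
  exact hc.norm_image_sub_le_of_norm_fderiv_le
    (fun x _ => hg.differentiable (by simp) x) (fun x hx => (hL x hx).trans (le_max_left _ _))
    hq hp

/-- A smooth one-parameter family starting at the identity is Lipschitz with constant
`1 + L h` on compact convex sets. -/
lemma exists_one_add_lipschitz {Φ : ℝ × V → V} (hΦ : ContDiff ℝ ∞ Φ) (h0 : ∀ z, Φ (0, z) = z)
    {K : Set V} (hK : IsCompact K) (hc : Convex ℝ K) :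
    ∃ L : ℝ, 0 ≤ L ∧ ∀ h ∈ Set.Icc (0 : ℝ) 1, ∀ z ∈ K, ∀ w ∈ K,
      ‖Φ (h, z) - Φ (h, w)‖ ≤ (1 + L * h) * ‖z - w‖ := by
  -- `∂Φ/∂h` is Lipschitz in `z`; integrating it from `h = 0`, where Φ is the identity, produces the
  -- term `L * h`.
  have hD : ContDiff ℝ ∞ (fun p : ℝ × V => fderiv ℝ Φ p (1, 0)) :=
    (hΦ.fderiv_right (m := ∞) le_rfl).clm_apply contDiff_const
  obtain ⟨L, hL0, hL⟩ := exists_lipschitz_of_contDiff hD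
    ((isCompact_Icc (a := (0 : ℝ)) (b := 1)).prod hK) ((convex_Icc 0 1).prod hc)
  refine ⟨L, hL0, fun h hh z hz w hw => ?_⟩
  have hd : ∀ (y : V) (r : ℝ),
      HasDerivAt (fun r => Φ (r, y)) (fderiv ℝ Φ (r, y) (1, 0)) r := fun y r =>
    ((hΦ.differentiable (by simp)) (r, y)).hasFDerivAt.comp_hasDerivAt r
      ((hasDerivAt_id r).prodMk (hasDerivAt_const r y))
  have := norm_le_mul_of_hasDerivWithinAt (M := L * ‖z - w‖) (δ := 1)
    (fun r _ => ((hd z r).sub (hd w r)).hasDerivWithinAt) hh (fun r hr => by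
      have hr' : r ∈ Set.Icc (0 : ℝ) 1 := ⟨hr.1, hr.2.trans hh.2⟩
      have := hL (r, z) ⟨hr', hz⟩ (r, w) ⟨hr', hw⟩
      simpa [Prod.norm_def] using this)
  simp only [Pi.sub_apply, h0] at this
  calc ‖Φ (h, z) - Φ (h, w)‖ = ‖(Φ (h, z) - Φ (h, w) - (z - w)) + (z - w)‖ := by simp
    _ ≤ L * ‖z - w‖ * h + ‖z - w‖ := (norm_add_le _ _).trans (by linarith)
    _ = _ := by ring

/-- Discrete Gronwall inequality. -/
lemma le_pow_mul_of_recursion {e : ℕ → ℝ} {a b : ℝ} (ha : 1 ≤ a) (hb : 0 ≤ b) (h0 : e 0 ≤ 0)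
    {n : ℕ} (h : ∀ j < n, e (j + 1) ≤ a * e j + b) : ∀ j ≤ n, e j ≤ a ^ j * (j * b) := by
  intro j
  induction j with
  | zero => intro _; simpa using h0
  | succ j ih =>
    intro hj
    have h1 := h j (by omega)
    have h2 := mul_le_mul_of_nonneg_left (ih (by omega)) (by linarith : (0 : ℝ) ≤ a)
    have h3 : b ≤ a ^ (j + 1) * b := le_mul_of_one_le_left hb (one_le_pow₀ ha)
    calc e (j + 1) ≤ a * (a ^ j * (j * b)) + a ^ (j + 1) * b := by linarith
      _ = _ := by push_cast; ring

/-- Composing a first order one-step method `Φ` with its adjoint `Ψ` gives a second order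
method. -/
theorem exists_second_order_bound {F : V → V} {Φ Ψ : ℝ × V → V} (hF : ContDiff ℝ ∞ F)
    (hΦ : ContDiff ℝ ∞ Φ) (hΨ : ContDiff ℝ ∞ Ψ) (hΦ0 : ∀ z, Φ (0, z) = z)
    (hΨ0 : ∀ z, Ψ (0, z) = z) (hΦF : ∀ z, HasDerivAt (fun h => Φ (h, z)) (F z) 0)
    (hadj : ∀ h z, Ψ (h, Φ (-h, z)) = z) {K : Set V} (hK : IsCompact K) (hc : Convex ℝ K)
    {τ : ℝ} (hτ : 0 ≤ τ) :
    ∃ C : ℝ, 0 ≤ C ∧ ∀ z : ℝ → V, (∀ t ∈ Set.Icc 0 τ, z t ∈ K) →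
      (∀ t ∈ Set.Icc 0 τ, HasDerivWithinAt z (F (z t)) (Set.Icc 0 τ) t) →
      ∀ δ, 0 < δ → δ ≤ 1 →
      (∀ t ∈ Set.Icc 0 τ, Φ (δ, z t) ∈ K ∧ Φ (-δ, z t) ∈ K) →
      ∀ Z : ℕ → V, Z 0 = z 0 → (∀ j, Z (2 * j + 1) = Φ (δ, Z (2 * j))) →
      (∀ j, Z (2 * j + 2) = Ψ (δ, Z (2 * j + 1))) → (∀ k : ℕ, k * δ ≤ τ → Z k ∈ K) →
      ∀ k : ℕ, k * δ ≤ τ → ‖Z k - z (k * δ)‖ ≤ C * δ ^ 2 := by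
  obtain ⟨L₁, hL₁0, hL₁⟩ := exists_one_add_lipschitz hΦ hΦ0 hK hc
  obtain ⟨L₂, hL₂0, hL₂⟩ := exists_one_add_lipschitz hΨ hΨ0 hK hc
  set P₁ := backwardDeriv F Φ with hP₁
  set P₂ := backwardDeriv F P₁ with hP₂
  set P₃ := backwardDeriv F P₂ with hP₃
  have cP₁ : ContDiff ℝ ∞ P₁ := contDiff_backwardDeriv hF hΦ
  have cP₂ : ContDiff ℝ ∞ P₂ := contDiff_backwardDeriv hF cP₁
  have cP₃ : ContDiff ℝ ∞ P₃ := contDiff_backwardDeriv hF cP₂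
  have hK' := (isCompact_Icc (a := (-1 : ℝ)) (b := 1)).prod hK
  obtain ⟨M₂, hM₂⟩ := hK'.exists_bound_of_continuousOn cP₂.continuous.continuousOn
  obtain ⟨M₃, hM₃⟩ := hK'.exists_bound_of_continuousOn cP₃.continuous.continuousOn
  -- Consistency: the `h`-derivative of Φ contributes `F z`, and the `z`-derivative, the identity at
  -- `h = 0`, contributes `-F z`.
  have hP₁0 : ∀ z, P₁ (0, z) = 0 := by
    intro z
    have hd := ((hΦ.differentiable (by simp)) (0, z)).hasFDerivAt
    have h1 := (hd.comp_hasDerivAt (0 : ℝ)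
      ((hasDerivAt_id (0 : ℝ)).prodMk (hasDerivAt_const (0 : ℝ) z))).unique (hΦF z)
    have h2 : fderiv ℝ Φ (0, z) (0, F z) = F z := by
      have ha := hd.comp z ((hasFDerivAt_const (0 : ℝ) z).prodMk (hasFDerivAt_id z))
      have hb : HasFDerivAt (Φ ∘ fun y => ((0 : ℝ), y)) (ContinuousLinearMap.id ℝ V) z := by
        have : (Φ ∘ fun y => ((0 : ℝ), y)) = id := funext fun y => hΦ0 y
        rw [this]; exact hasFDerivAt_id z
      simpa using congrArg (fun l : V →L[ℝ] V => l (F z)) (ha.unique hb)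
    have h3 : ((1 : ℝ), -F z) = (1, 0) - (0, F z) := by simp
    simp only [hP₁, backwardDeriv]
    rw [h3, map_sub, h2, h1, sub_self]
  set M := max (max M₂ M₃) 0 with hM
  have hM0 : 0 ≤ M := le_max_right _ _
  set c := (1 + L₂) * (2 * M) with hcdef
  set C₀ := Real.exp ((L₁ + L₂) * τ) * (τ * c) with hC₀
  have hc0 : 0 ≤ c := by positivity
  have hC₀0 : 0 ≤ C₀ := by positivity
  refine ⟨(1 + L₁) * C₀ + M, by positivity, ?_⟩
  intro z hzK hz δ hδ hδ1 hzΦ Z hZ0 hZodd hZeven hZK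
  have hδI : δ ∈ Set.Icc (0 : ℝ) 1 := ⟨hδ.le, hδ1⟩
  have even : ∀ j : ℕ, ((2 * j : ℕ) : ℝ) * δ ≤ τ →
      ‖Z (2 * j) - z ((2 * j : ℕ) * δ)‖ ≤ C₀ * δ ^ 2 := by
    intro j₀ hj₀
    have hrec := le_pow_mul_of_recursion (e := fun j => ‖Z (2 * j) - z ((2 * j : ℕ) * δ)‖)
      (a := (1 + L₂ * δ) * (1 + L₁ * δ)) (b := c * δ ^ 3) (n := j₀)
      (by
        have : 0 ≤ L₁ * δ := by positivity
        have : 0 ≤ L₂ * δ := by positivity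
        nlinarith)
      (by positivity) (by simp [hZ0]) ?_ j₀ le_rfl
    · refine hrec.trans ?_
      have h1 : (1 + L₂ * δ) * (1 + L₁ * δ) ≤ Real.exp ((L₁ + L₂) * δ) := by
        rw [add_mul L₁, add_comm (L₁ * δ), Real.exp_add]
        gcongr
        · linarith [Real.add_one_le_exp (L₂ * δ)]
        · linarith [Real.add_one_le_exp (L₁ * δ)]
      have h2 : (j₀ : ℝ) * δ ≤ τ := by
        push_cast at hj₀
        have : 0 ≤ (j₀ : ℝ) * δ := by positivity
        linarith
      calc ((1 + L₂ * δ) * (1 + L₁ * δ)) ^ j₀ * (j₀ * (c * δ ^ 3))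
          ≤ Real.exp ((L₁ + L₂) * δ) ^ j₀ * (j₀ * (c * δ ^ 3)) := by gcongr
        _ = Real.exp ((L₁ + L₂) * (j₀ * δ)) * ((j₀ * δ) * c) * δ ^ 2 := by
          rw [← Real.exp_nat_mul]; ring_nf
        _ ≤ C₀ * δ ^ 2 := by rw [hC₀]; gcongr
    · intro j hj
      set t := ((2 * j : ℕ) : ℝ) * δ with ht
      have ht2 : ((2 * (j + 1) : ℕ) : ℝ) * δ = t + 2 * δ := by rw [ht]; push_cast; ring
      have hle : t + 2 * δ ≤ τ := by
        rw [← ht2]; refine le_trans ?_ hj₀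
        gcongr; omega
      have ht0 : 0 ≤ t := by positivity
      have htI : t ∈ Set.Icc 0 τ := ⟨ht0, by linarith⟩
      have htI2 : t + 2 * δ ∈ Set.Icc 0 τ := ⟨by linarith, hle⟩
      have hI : ∀ h ∈ Set.Icc (-δ) δ, t + δ - h ∈ Set.Icc 0 τ := fun h hh =>
        ⟨by linarith [hh.2], by linarith [hh.1]⟩
      have hcube := norm_sub_neg_le_cube (M := M) hδ.le
        (fun r hr => hasDerivWithinAt_comp_backward hΦ hz hI hr)
        (fun r hr => hasDerivWithinAt_comp_backward cP₁ hz hI hr)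
        (fun r hr => hasDerivWithinAt_comp_backward cP₂ hz hI hr)
        (hP₁0 _) (fun r hr => (hM₃ (r, z (t + δ - r))
          ⟨⟨by linarith [hr.1], by linarith [hr.2]⟩, hzK _ (hI r hr)⟩).trans
          ((le_max_right _ _).trans (le_max_left _ _)))
      have e1 : t + δ - δ = t := by ring
      have e2 : t + δ - -δ = t + 2 * δ := by ring
      rw [e1, e2] at hcube
      have hZj : Z (2 * j) ∈ K := hZK _ htI.2
      have hZj1 : Φ (δ, Z (2 * j)) ∈ K := by
        rw [← hZodd]; apply hZK
        push_cast; push_cast at ht; linarith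
      -- Through the adjoint relation the comparison moves to the intermediate stage, where `hcube`
      -- applies.
      have hback : z (t + 2 * δ) = Ψ (δ, Φ (-δ, z (t + 2 * δ))) := (hadj _ _).symm
      have b1 := hL₂ δ hδI _ hZj1 _ (hzΦ _ htI2).2
      have b2 := hL₁ δ hδI _ hZj _ (hzK t htI)
      have b3 : ‖Φ (δ, Z (2 * j)) - Φ (-δ, z (t + 2 * δ))‖ ≤
          (1 + L₁ * δ) * ‖Z (2 * j) - z t‖ + 2 * M * δ ^ 3 :=
        (norm_sub_le_norm_sub_add_norm_sub _ (Φ (δ, z t)) _).trans (add_le_add b2 hcube)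
      have b4 : (1 + L₂ * δ) * (2 * M * δ ^ 3) ≤ c * δ ^ 3 := by
        have : L₂ * δ ≤ L₂ := mul_le_of_le_one_right hL₂0 hδ1
        calc _ ≤ (1 + L₂) * (2 * M * δ ^ 3) := by gcongr
          _ = _ := by rw [hcdef]; ring
      calc ‖Z (2 * (j + 1)) - z ((2 * (j + 1) : ℕ) * δ)‖
          = ‖Ψ (δ, Φ (δ, Z (2 * j))) - Ψ (δ, Φ (-δ, z (t + 2 * δ)))‖ := by
            rw [ht2, ← hback, ← hZodd, ← hZeven]; rfl
        _ ≤ (1 + L₂ * δ) * ((1 + L₁ * δ) * ‖Z (2 * j) - z t‖ + 2 * M * δ ^ 3) :=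
            b1.trans (by gcongr)
        _ ≤ (1 + L₂ * δ) * (1 + L₁ * δ) * ‖Z (2 * j) - z t‖ + c * δ ^ 3 := by
            linarith
  intro k hk
  rcases Nat.even_or_odd' k with ⟨j, rfl | rfl⟩
  · refine (even j hk).trans ?_
    have h1 : 0 ≤ L₁ * C₀ := by positivity
    gcongr
    linarith
  -- An odd index costs one extra Φ-step, whose `O(δ²)` local error occurs only once and does not
  -- accumulate.
  · set t := ((2 * j : ℕ) : ℝ) * δ with ht
    have ht2 : ((2 * j + 1 : ℕ) : ℝ) * δ = t + δ := by rw [ht]; push_cast; ring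
    rw [ht2] at hk ⊢
    have ht0 : 0 ≤ t := by positivity
    have htI : t ∈ Set.Icc 0 τ := ⟨ht0, by linarith⟩
    have hI : ∀ h ∈ Set.Icc 0 δ, t + δ - h ∈ Set.Icc 0 τ := fun h hh =>
      ⟨by linarith [hh.2], by linarith [hh.1]⟩
    have hsq := norm_sub_le_sq (M := M) hδ.le
      (fun r hr => hasDerivWithinAt_comp_backward hΦ hz hI hr)
      (fun r hr => hasDerivWithinAt_comp_backward cP₁ hz hI hr)
      (hP₁0 _) (fun r hr => (hM₂ (r, z (t + δ - r))
        ⟨⟨by linarith [hr.1], by linarith [hr.2]⟩, hzK _ (hI r hr)⟩).trans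
        ((le_max_left _ _).trans (le_max_left _ _)))
    rw [hΦ0, sub_zero, add_sub_cancel_right] at hsq
    have b2 := hL₁ δ hδI _ (hZK _ htI.2) _ (hzK t htI)
    have b5 : 1 + L₁ * δ ≤ 1 + L₁ := by
      have : L₁ * δ ≤ L₁ := mul_le_of_le_one_right hL₁0 hδ1
      linarith
    calc ‖Z (2 * j + 1) - z (t + δ)‖
        ≤ ‖Φ (δ, Z (2 * j)) - Φ (δ, z t)‖ + ‖Φ (δ, z t) - z (t + δ)‖ := by
          rw [hZodd]; exact norm_sub_le_norm_sub_add_norm_sub _ _ _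
      _ ≤ (1 + L₁) * (C₀ * δ ^ 2) + M * δ ^ 2 := by
          refine add_le_add (b2.trans ?_) hsq
          exact mul_le_mul b5 (even j htI.2) (norm_nonneg _) (by positivity)
      _ = _ := by ring

end AdjointComposition

/-! ### Derivatives of the projection `N` and consistency of the reflected Hug step. -/

section Geometry
variable {n m : ℕ}

lemma isInvertible_comp_adjoint {A : E n →L[ℝ] E m} (hA : Function.Surjective A) :
    (A ∘L A.adjoint).IsInvertible := by
  have hinj : Function.Injective (A ∘L A.adjoint) := by
    rw [injective_iff_map_eq_zero]
    intro y hy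
    have h1 : A.adjoint y = 0 := by
      rw [← inner_self_eq_zero (𝕜 := ℝ), ContinuousLinearMap.adjoint_inner_left]
      have : A (A.adjoint y) = 0 := hy
      rw [this, inner_zero_right]
    obtain ⟨w, rfl⟩ := hA y
    rw [← inner_self_eq_zero (𝕜 := ℝ), ← ContinuousLinearMap.adjoint_inner_right, h1,
      inner_zero_right]
  refine ⟨(LinearEquiv.ofInjectiveEndo (A ∘L A.adjoint).toLinearMap
    hinj).toContinuousLinearEquiv, ?_⟩
  ext1 y
  rfl

lemma contDiff_adjoint :
    ContDiff ℝ ∞ (fun A : E n →L[ℝ] E m => A.adjoint) := by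
  refine IsBoundedLinearMap.contDiff (𝕜 := ℝ) ⟨⟨?_, ?_⟩, 1, one_pos, ?_⟩
  · intro A B; exact map_add _ _ _
  · intro r A; simp
  · intro A; simp

variable {f : E n → E m}

/-- `f` is a smooth submersion. -/
structure IsSubmersion (f : E n → E m) : Prop where
  contDiff : ContDiff ℝ ∞ f
  surjective : ∀ x, Function.Surjective (J f x)

lemma contDiff_J (hf : IsSubmersion f) : ContDiff ℝ ∞ (J f) :=
  hf.contDiff.fderiv_right (m := ∞) le_rfl

lemma contDiff_N (hf : IsSubmersion f) : ContDiff ℝ ∞ (N f) := by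
  have hJ := contDiff_J hf
  have hJt : ContDiff ℝ ∞ (fun x => (J f x).adjoint) := contDiff_adjoint.comp hJ
  have hinv : ContDiff ℝ ∞ (fun x => (J f x ∘L (J f x).adjoint).inverse) := by
    rw [contDiff_iff_contDiffAt]
    intro x
    obtain ⟨e, he⟩ := isInvertible_comp_adjoint (hf.surjective x)
    have h1 := contDiffAt_map_inverse (𝕜 := ℝ) (n := ∞) e
    rw [he] at h1
    exact h1.comp x (hJ.clm_comp hJt).contDiffAt
  exact (hJt.clm_comp hinv).clm_comp hJ

lemma J_comp_Jplus (hf : IsSubmersion f) (x : E n) :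
    J f x ∘L Jplus f x = ContinuousLinearMap.id ℝ (E m) := by
  rw [Jplus, ← ContinuousLinearMap.comp_assoc]
  exact (isInvertible_comp_adjoint (hf.surjective x)).self_comp_inverse

lemma J_comp_N (hf : IsSubmersion f) (x : E n) : J f x ∘L N f x = J f x := by
  rw [N, ← ContinuousLinearMap.comp_assoc, J_comp_Jplus hf, ContinuousLinearMap.id_comp]

lemma N_comp_N (hf : IsSubmersion f) (x : E n) : N f x ∘L N f x = N f x := by
  conv_lhs => rw [N]
  rw [ContinuousLinearMap.comp_assoc, ← N, J_comp_N hf, N]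

lemma adjoint_N (hf : IsSubmersion f) (x : E n) : (N f x).adjoint = N f x := by
  set B := J f x ∘L (J f x).adjoint with hB
  have hinv := isInvertible_comp_adjoint (hf.surjective x)
  have hBt : B.adjoint = B := by
    rw [hB, ContinuousLinearMap.adjoint_comp, ContinuousLinearMap.adjoint_adjoint]
  have hBi : B.inverse.adjoint = B.inverse := by
    have h1 : B.inverse.adjoint ∘L B = ContinuousLinearMap.id ℝ _ := by
      calc _ = B.inverse.adjoint ∘L B.adjoint := by rw [hBt]
        _ = _ := by
          rw [← ContinuousLinearMap.adjoint_comp, hinv.self_comp_inverse,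
            ContinuousLinearMap.adjoint_id]
    calc B.inverse.adjoint = B.inverse.adjoint ∘L (B ∘L B.inverse) := by
          rw [hinv.self_comp_inverse, ContinuousLinearMap.comp_id]
      _ = B.inverse := by
          rw [← ContinuousLinearMap.comp_assoc, h1, ContinuousLinearMap.id_comp]
  rw [N, Jplus, ← hB, ContinuousLinearMap.adjoint_comp, ContinuousLinearMap.adjoint_comp, hBi,
    ContinuousLinearMap.adjoint_adjoint, ContinuousLinearMap.comp_assoc]

lemma hasFDerivAt_N (hf : IsSubmersion f) (x : E n) :
    HasFDerivAt (N f) (fderiv ℝ (N f) x) x :=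
  ((contDiff_N hf).differentiable (by simp) x).hasFDerivAt

/-- Differentiate `N ∘ N = N`. -/
lemma fderiv_N_eq_comp (hf : IsSubmersion f) (x w : E n) :
    fderiv ℝ (N f) x w = N f x ∘L fderiv ℝ (N f) x w + fderiv ℝ (N f) x w ∘L N f x := by
  have h1 := (hasFDerivAt_N hf x).clm_comp (hasFDerivAt_N hf x)
  have h2 : (fun y => N f y ∘L N f y) = N f := funext (N_comp_N hf)
  rw [h2] at h1
  have := congrArg (fun l => l w) ((hasFDerivAt_N hf x).unique h1)
  simpa using this

lemma adjoint_fderiv_N (hf : IsSubmersion f) (x w : E n) :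
    (fderiv ℝ (N f) x w).adjoint = fderiv ℝ (N f) x w := by
  have h1 := (hasFDerivAt_N hf x)
  have key : ∀ a b : E n, inner ℝ (fderiv ℝ (N f) x w a) b = inner ℝ a (fderiv ℝ (N f) x w b) := by
    intro a b
    have ha := (h1.clm_apply (hasFDerivAt_const a x)).inner ℝ (hasFDerivAt_const b x)
    have hb := (hasFDerivAt_const a x).inner ℝ (h1.clm_apply (hasFDerivAt_const b x))
    have he : (fun y => inner ℝ (N f y a) b) = (fun y => inner ℝ a (N f y b)) := by
      funext y
      conv_lhs => rw [← adjoint_N hf y]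
      rw [ContinuousLinearMap.adjoint_inner_left]
    rw [he] at ha
    have := congrArg (fun l => l w) (ha.unique hb)
    simpa using this
  refine (ContinuousLinearMap.eq_adjoint_iff _ _).2 (fun a b => ?_) |>.symm
  exact key a b

/-- Differentiate `J ∘ N = J` and multiply by `Jplus` on the left. -/
lemma N_comp_fderiv_N (hf : IsSubmersion f) (x w : E n) :
    N f x ∘L fderiv ℝ (N f) x w = Nperp' f x w := by
  have hJ : HasFDerivAt (J f) (fderiv ℝ (J f) x) x :=
    ((contDiff_J hf).differentiable (by simp) x).hasFDerivAt
  have h1 := hJ.clm_comp (hasFDerivAt_N hf x)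
  have h2 : (fun y => J f y ∘L N f y) = J f := funext (J_comp_N hf)
  rw [h2] at h1
  have h3 := congrArg (fun l => l w) (hJ.unique h1)
  have h4 : H f x w = J f x ∘L fderiv ℝ (N f) x w + H f x w ∘L N f x := by
    have : H f x w = fderiv ℝ (J f) x w := rfl
    rw [this]
    simpa using h3
  have h5 : J f x ∘L fderiv ℝ (N f) x w = H f x w ∘L T f x := by
    rw [T, ContinuousLinearMap.comp_sub, ContinuousLinearMap.comp_id]
    exact eq_sub_of_add_eq h4.symm
  rw [Nperp', ← h5, N, ContinuousLinearMap.comp_assoc]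

lemma fderiv_N_comp_N (hf : IsSubmersion f) (x w : E n) :
    fderiv ℝ (N f) x w ∘L N f x = Npar' f x w := by
  rw [Npar', ← N_comp_fderiv_N hf, ContinuousLinearMap.adjoint_comp, adjoint_N hf,
    adjoint_fderiv_N hf]

lemma contDiff_R (hf : IsSubmersion f) : ContDiff ℝ ∞ (R f) := by
  have hN := contDiff_N hf
  unfold R
  fun_prop

lemma R_apply (x v : E n) : R f x v = v - (2 : ℝ) • N f x v := by simp [R]

lemma T_apply (x v : E n) : T f x v = v - N f x v := by simp [T]

lemma N_N (hf : IsSubmersion f) (x v : E n) : N f x (N f x v) = N f x v :=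
  congrArg (fun l => l v) (N_comp_N hf x)

lemma R_R (hf : IsSubmersion f) (x v : E n) : R f x (R f x v) = v := by
  simp only [R_apply, map_sub, map_smul, N_N hf]
  module

/-- A self-adjoint involution is an isometry. -/
lemma norm_R (hf : IsSubmersion f) (x v : E n) : ‖R f x v‖ = ‖v‖ := by
  have hs : ∀ a b : E n, inner ℝ (N f x a) b = inner ℝ a (N f x b) := fun a b => by
    conv_lhs => rw [← adjoint_N hf x]
    rw [ContinuousLinearMap.adjoint_inner_left]
  have hRs : ∀ a b : E n, inner ℝ (R f x a) b = inner ℝ a (R f x b) := fun a b => by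
    simp [R_apply, inner_sub_left, inner_sub_right, inner_smul_left, inner_smul_right, hs]
  have hR := hRs v (R f x v)
  rw [R_R hf, real_inner_self_eq_norm_sq, real_inner_self_eq_norm_sq] at hR
  exact (sq_eq_sq₀ (norm_nonneg _) (norm_nonneg _)).1 hR

lemma T_eq_half (x v : E n) : T f x v = (1 / 2 : ℝ) • (v + R f x v) := by
  rw [T_apply, R_apply]; module

lemma norm_T_le (hf : IsSubmersion f) (x v : E n) : ‖T f x v‖ ≤ ‖v‖ := by
  rw [T_eq_half, norm_smul]
  have := norm_add_le v (R f x v)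
  rw [norm_R hf] at this
  norm_num
  linarith

/-- The reflection of the velocity in the tangent space. -/
noncomputable def reflect (f : E n → E m) (p : E n × E n) : E n × E n := (p.1, R f p.1 p.2)

lemma reflect_reflect (hf : IsSubmersion f) (p : E n × E n) : reflect f (reflect f p) = p := by
  simp [reflect, R_R hf]

lemma contDiff_reflect (hf : IsSubmersion f) : ContDiff ℝ ∞ (reflect f) :=
  contDiff_fst.prodMk (((contDiff_R hf).comp contDiff_fst).clm_apply contDiff_snd)

lemma contDiff_step (hf : IsSubmersion f) :
    ContDiff ℝ ∞ (fun q : ℝ × (E n × E n) => step f q.1 q.2) := by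
  have hR := contDiff_R hf
  unfold step
  fun_prop

lemma step_zero (p : E n × E n) : step f 0 p = reflect f p := by
  simp [step, reflect]

lemma step_step_neg (hf : IsSubmersion f) (h : ℝ) (p : E n × E n) :
    step f h (step f (-h) p) = p := by
  obtain ⟨x, v⟩ := p
  have e : x + (-h / 2) • v + (-h / 2) • R f (x + (-h / 2) • v) v
      + (h / 2) • R f (x + (-h / 2) • v) v = x + (-h / 2) • v := by module
  simp only [step, e, R_R hf]
  congr 1
  module

lemma norm_step_snd (hf : IsSubmersion f) (h : ℝ) (p : E n × E n) :
    ‖(step f h p).2‖ = ‖p.2‖ := norm_R hf _ _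

lemma norm_step_fst_sub_le (hf : IsSubmersion f) (h : ℝ) (p : E n × E n) :
    ‖(step f h p).1 - p.1‖ ≤ |h| * ‖p.2‖ := by
  have e : (step f h p).1 - p.1 = (h / 2) • (p.2 + R f (p.1 + (h / 2) • p.2) p.2) := by
    simp only [step]; module
  rw [e, norm_smul, Real.norm_eq_abs, abs_div, abs_two]
  have := norm_add_le p.2 (R f (p.1 + (h / 2) • p.2) p.2)
  rw [norm_R hf] at this
  calc |h| / 2 * _ ≤ |h| / 2 * (‖p.2‖ + ‖p.2‖) := by gcongr
    _ = _ := by ring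

/-- The right-hand side of the limiting differential equation. -/
noncomputable def vectorField (f : E n → E m) (p : E n × E n) : E n × E n :=
  (T f p.1 p.2, (Npar' f p.1 ((T f p.1 - N f p.1) p.2)
    - Nperp' f p.1 ((T f p.1 - N f p.1) p.2)) p.2)

lemma hasDerivAt_R_comp (hf : IsSubmersion f) {y : ℝ → E n} {y' : E n} {t : ℝ}
    (hy : HasDerivAt y y' t) :
    HasDerivAt (fun t => R f (y t)) (-((2 : ℝ) • fderiv ℝ (N f) (y t) y')) t :=
  (((hasFDerivAt_N hf (y t)).comp_hasDerivAt t hy).const_smul (2 : ℝ)).const_sub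
    (ContinuousLinearMap.id ℝ (E n))

lemma hasDerivAt_reflect_step (hf : IsSubmersion f) (p : E n × E n) :
    HasDerivAt (fun h => reflect f (step f h p)) (vectorField f p) 0 := by
  obtain ⟨x, u⟩ := p
  have hhalf : HasDerivAt (fun h : ℝ => h / 2) (1 / 2) 0 := (hasDerivAt_id (0 : ℝ)).div_const 2
  have hxh : HasDerivAt (fun h : ℝ => x + (h / 2) • u) ((1 / 2 : ℝ) • u) 0 :=
    (hhalf.smul_const u).const_add x
  have hv := (hasDerivAt_R_comp hf hxh).clm_apply (hasDerivAt_const (0 : ℝ) u)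
  have hx := hxh.fun_add (hhalf.fun_smul hv)
  have hu := (hasDerivAt_R_comp hf hx).clm_apply hv
  have hfin := hx.prodMk hu
  refine hfin.congr_deriv ?_
  -- By `N' = N N' + N' N`, the derivative of `N` anticommutes with `R = I - 2N`. The velocity
  -- derivative `-2 N'[T u] R u - R N'[u] u` thus becomes `-N'[(2T - I) u] R u`, where `2T - I = T -
  -- N`.
  have hRN : ∀ w y : E n, R f x (fderiv ℝ (N f) x w y) = -fderiv ℝ (N f) x w (R f x y) := by
    intro w y
    have h1 := congrArg (fun l => l y) (fderiv_N_eq_comp hf x w)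
    simp only [add_apply, ContinuousLinearMap.comp_apply] at h1
    simp only [R_apply, map_sub, map_smul]
    generalize fderiv ℝ (N f) x w y = a at *
    generalize fderiv ℝ (N f) x w (N f x y) = b at *
    nth_rewrite 1 [h1]
    nth_rewrite 3 [h1]
    module
  have hNR : ∀ w y : E n, fderiv ℝ (N f) x w (R f x y) = Nperp' f x w y - Npar' f x w y := by
    intro w y
    have h1 := congrArg (fun l => l y) (fderiv_N_eq_comp hf x w)
    rw [N_comp_fderiv_N hf, fderiv_N_comp_N hf] at h1
    rw [R_apply, map_sub, map_smul, ← fderiv_N_comp_N hf]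
    simp only [add_apply, ← fderiv_N_comp_N hf,
      ContinuousLinearMap.comp_apply] at h1
    rw [ContinuousLinearMap.comp_apply, h1]
    module
  have hTN : (T f x - N f x) u = (2 : ℝ) • T f x u - u := by
    simp only [sub_apply, T_apply]; module
  refine Prod.ext ?_ ?_
  · simp only [vectorField, T_eq_half]
    simp
  · have hT : (1 / 2 : ℝ) • u + (1 / 2 : ℝ) • R f x u = T f x u := by rw [T_eq_half]; module
    simp only [vectorField, zero_div, zero_smul, add_zero, zero_add, map_zero,
      sub_apply (Npar' f x _)]
    rw [← neg_sub (Nperp' f x _ _), ← hNR, hTN]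
    simp only [hT, map_smul, map_sub, map_neg, smul_apply, neg_apply, hRN, sub_apply, smul_neg,
      neg_neg]
    module

end Geometry
-- A priori bounds on the solution and the iterates.
section Convergence
variable {n m : ℕ} {f : E n → E m}

lemma isSubmersion_of_finrank_range (hf : ContDiff ℝ ∞ f)
    (hrank : ∀ x : E n, Module.finrank ℝ (LinearMap.range (J f x).toLinearMap) = m) :
    IsSubmersion f := by
  refine ⟨hf, fun x => ?_⟩
  have h : LinearMap.range (J f x).toLinearMap = ⊤ :=
    Submodule.eq_top_of_finrank_eq (by rw [hrank, finrank_euclideanSpace_fin])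
  exact LinearMap.range_eq_top.1 h

lemma contDiff_reflect_step (hf : IsSubmersion f) :
    ContDiff ℝ ∞ (fun q : ℝ × (E n × E n) => reflect f (step f q.1 q.2)) :=
  (contDiff_reflect hf).comp (contDiff_step hf)

lemma contDiff_step_reflect (hf : IsSubmersion f) :
    ContDiff ℝ ∞ (fun q : ℝ × (E n × E n) => step f q.1 (reflect f q.2)) :=
  (contDiff_step hf).comp (contDiff_fst.prodMk ((contDiff_reflect hf).comp contDiff_snd))

/-- Smoothness is inherited from the one-step method, of which the field is the `h`-derivative at `h
= 0`. -/
lemma contDiff_vectorField (hf : IsSubmersion f) : ContDiff ℝ ∞ (vectorField f) := by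
  set Φ := fun q : ℝ × (E n × E n) => reflect f (step f q.1 q.2) with hΦ
  have cΦ : ContDiff ℝ ∞ Φ := contDiff_reflect_step hf
  have h : vectorField f = fun p => fderiv ℝ Φ (0, p) (1, 0) := by
    funext p
    refine (hasDerivAt_reflect_step hf p).unique ?_
    exact ((cΦ.differentiable (by simp)) (0, p)).hasFDerivAt.comp_hasDerivAt (0 : ℝ)
      ((hasDerivAt_id (0 : ℝ)).prodMk (hasDerivAt_const (0 : ℝ) p))
  rw [h]
  exact ((cΦ.fderiv_right (m := ∞) le_rfl).comp (contDiff_const.prodMk contDiff_id)).clm_apply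
    contDiff_const

/-- The velocity equation has the form `v' = (Aᵀ - A) v` with a skew matrix, so the speed is
conserved. -/
lemma norm_velocity_eq {τ : ℝ} {x v : ℝ → E n} (h : IsSolution f τ x v) {t : ℝ}
    (ht : t ∈ Set.Icc 0 τ) : ‖v t‖ = ‖v 0‖ := by
  have skew : ∀ (A : E n →L[ℝ] E n) (u : E n),
      inner ℝ u ((A.adjoint - A) u) + inner ℝ ((A.adjoint - A) u) u = 0 := fun A u => by
    simp only [sub_apply, inner_sub_left, inner_sub_right,
      ContinuousLinearMap.adjoint_inner_left, ContinuousLinearMap.adjoint_inner_right]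
    ring
  have h1 := norm_le_mul_of_hasDerivWithinAt (g := fun t => inner ℝ (v t) (v t)) (M := 0)
    (fun r hr => (h.deriv_v r hr).inner ℝ (h.deriv_v r hr)) ht (fun r _ =>
      norm_le_zero_iff.2 (skew _ _))
  rw [zero_mul, norm_le_zero_iff, sub_eq_zero, real_inner_self_eq_norm_sq,
    real_inner_self_eq_norm_sq] at h1
  exact (sq_eq_sq₀ (norm_nonneg _) (norm_nonneg _)).1 h1

lemma norm_position_sub_le (hf : IsSubmersion f) {τ : ℝ} {x v : ℝ → E n}
    (h : IsSolution f τ x v) {t : ℝ} (ht : t ∈ Set.Icc 0 τ) : ‖x t - x 0‖ ≤ ‖v 0‖ * t :=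
  norm_le_mul_of_hasDerivWithinAt h.deriv_x ht fun _ hr =>
    (norm_T_le hf _ _).trans_eq (norm_velocity_eq h ⟨hr.1, hr.2.trans ht.2⟩)

lemma norm_iter_snd (hf : IsSubmersion f) (δ : ℝ) (x₀ v₀ : E n) (k : ℕ) :
    ‖(iter f δ x₀ v₀ k).2‖ = ‖v₀‖ := by
  induction k with
  | zero => rfl
  | succ k ih => rw [iter, norm_step_snd hf, ih]

lemma norm_iter_fst_sub_le (hf : IsSubmersion f) {δ : ℝ} (hδ : 0 ≤ δ) (x₀ v₀ : E n) (k : ℕ) :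
    ‖(iter f δ x₀ v₀ k).1 - x₀‖ ≤ ‖v₀‖ * (k * δ) := by
  induction k with
  | zero => simp [iter]
  | succ k ih =>
    have h1 := norm_step_fst_sub_le hf δ (iter f δ x₀ v₀ k)
    rw [abs_of_nonneg hδ, norm_iter_snd hf] at h1
    have h2 := norm_sub_le_norm_sub_add_norm_sub (iter f δ x₀ v₀ (k + 1)).1
      (iter f δ x₀ v₀ k).1 x₀
    rw [iter] at h2 ⊢
    push_cast
    linarith

/-- The Hug iterates with the velocity reflected at odd times. -/
noncomputable def reflectedIter (f : E n → E m) (δ : ℝ) (x₀ v₀ : E n) (k : ℕ) : E n × E n :=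
  if Even k then iter f δ x₀ v₀ k else reflect f (iter f δ x₀ v₀ k)

lemma reflectedIter_two_mul (δ : ℝ) (x₀ v₀ : E n) (j : ℕ) :
    reflectedIter f δ x₀ v₀ (2 * j) = iter f δ x₀ v₀ (2 * j) := by
  simp [reflectedIter]

lemma reflectedIter_two_mul_add_one (δ : ℝ) (x₀ v₀ : E n) (j : ℕ) :
    reflectedIter f δ x₀ v₀ (2 * j + 1) = reflect f (iter f δ x₀ v₀ (2 * j + 1)) := by
  simp [reflectedIter]

lemma reflectedIter_fst (δ : ℝ) (x₀ v₀ : E n) (k : ℕ) :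
    (reflectedIter f δ x₀ v₀ k).1 = (iter f δ x₀ v₀ k).1 := by
  unfold reflectedIter; split_ifs <;> rfl

lemma norm_reflectedIter_snd (hf : IsSubmersion f) (δ : ℝ) (x₀ v₀ : E n) (k : ℕ) :
    ‖(reflectedIter f δ x₀ v₀ k).2‖ = ‖v₀‖ := by
  unfold reflectedIter
  split_ifs
  · exact norm_iter_snd hf _ _ _ _
  · exact (norm_R hf _ _).trans (norm_iter_snd hf _ _ _ _)

end Convergence
end Hug

/-! ### The convergence theorem. -/

theorem mainTheorem1 (n m : ℕ) (hm : 0 < m) (hmn : m < n)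
    (f : Hug.E n → Hug.E m) (hf : ContDiff ℝ ∞ f)
    (hrank : ∀ x : Hug.E n, Module.finrank ℝ (LinearMap.range (Hug.J f x).toLinearMap) = m)
    (x₀ v₀ : Hug.E n) (τ : ℝ) (hτ : 0 ≤ τ) :
    ∃ C > (0 : ℝ), ∃ δ₀ > (0 : ℝ), ∀ x v : ℝ → Hug.E n,
      Hug.IsSolution f τ x v → x 0 = x₀ → v 0 = v₀ →
      ∀ δ : ℝ, 0 < δ → δ ≤ δ₀ → ∀ k : ℕ, (k : ℝ) * δ ≤ τ →
        ‖(Hug.iter f δ x₀ v₀ k).1 - x (k * δ)‖ ≤ C * δ ^ 2 ∧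
        ‖(Hug.iter f δ x₀ v₀ k).2 - (Hug.T f (x (k * δ)) (v (k * δ))
            + (-1 : ℝ) ^ k • Hug.N f (x (k * δ)) (v (k * δ)))‖ ≤ C * δ ^ 2 := by
  have hs := Hug.isSubmersion_of_finrank_range hf hrank
  -- Positions on `[0, τ]` stay within `‖v₀‖ * τ` of `x₀`; the extra 1 leaves room for one step of
  -- length at most 1 from the exact solution.
  set K : Set (Hug.E n × Hug.E n) :=
    Metric.closedBall x₀ (‖v₀‖ * (τ + 1)) ×ˢ Metric.closedBall 0 ‖v₀‖ with hKdef
  have hK : IsCompact K := (isCompact_closedBall _ _).prod (isCompact_closedBall _ _)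
  have hc : Convex ℝ K := (convex_closedBall _ _).prod (convex_closedBall _ _)
  have memK : ∀ p : Hug.E n × Hug.E n, p ∈ K ↔ ‖p.1 - x₀‖ ≤ ‖v₀‖ * (τ + 1) ∧ ‖p.2‖ ≤ ‖v₀‖ := by
    intro p
    simp [hKdef, Set.mem_prod, dist_eq_norm]
  obtain ⟨C, hC0, hC⟩ := Hug.exists_second_order_bound (Hug.contDiff_vectorField hs)
    (Hug.contDiff_reflect_step hs) (Hug.contDiff_step_reflect hs)
    (fun z => by simp [Hug.step_zero, Hug.reflect_reflect hs])
    (fun z => by simp [Hug.step_zero, Hug.reflect_reflect hs])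
    (Hug.hasDerivAt_reflect_step hs)
    (fun h z => by simp only [Hug.reflect_reflect hs, Hug.step_step_neg hs]) hK hc hτ
  obtain ⟨L, hL0, hL⟩ := Hug.exists_lipschitz_of_contDiff (Hug.contDiff_reflect hs) hK hc
  refine ⟨(1 + L) * C + 1, by positivity, 1, one_pos, ?_⟩
  intro x v hsol hx0 hv0 δ hδ hδ1 k hk
  have hx : ∀ t ∈ Set.Icc 0 τ, ‖x t - x₀‖ ≤ ‖v₀‖ * τ := fun t ht => by
    have := Hug.norm_position_sub_le hs hsol ht
    rw [hx0, hv0] at this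
    exact this.trans (mul_le_mul_of_nonneg_left ht.2 (norm_nonneg _))
  have hv : ∀ t ∈ Set.Icc 0 τ, ‖v t‖ = ‖v₀‖ := fun t ht => by
    rw [Hug.norm_velocity_eq hsol ht, hv0]
  have hτK : ‖v₀‖ * τ ≤ ‖v₀‖ * (τ + 1) := by gcongr; linarith
  have hzK : ∀ t ∈ Set.Icc 0 τ, (x t, v t) ∈ K := fun t ht =>
    (memK _).2 ⟨(hx t ht).trans hτK, (hv t ht).le⟩
  have hΦK : ∀ t ∈ Set.Icc 0 τ, ∀ h : ℝ, |h| ≤ 1 →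
      Hug.reflect f (Hug.step f h (x t, v t)) ∈ K := by
    intro t ht h hh
    refine (memK _).2 ⟨?_, ?_⟩
    · have h1 := Hug.norm_step_fst_sub_le hs h (x t, v t)
      have h2 := norm_sub_le_norm_sub_add_norm_sub (Hug.step f h (x t, v t)).1 (x t) x₀
      have h3 : |h| * ‖v t‖ ≤ 1 * ‖v t‖ := by gcongr
      have h4 := hx t ht
      rw [hv t ht] at h3
      simp only [hv t ht] at h1
      simp only [Hug.reflect]
      linarith
    · exact (Hug.norm_R hs _ _).trans_le ((Hug.norm_step_snd hs _ _).trans_le (hv t ht).le)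
  have hZK : ∀ k : ℕ, k * δ ≤ τ → Hug.reflectedIter f δ x₀ v₀ k ∈ K := by
    intro k hk
    refine (memK _).2 ⟨?_, (Hug.norm_reflectedIter_snd hs _ _ _ _).le⟩
    rw [Hug.reflectedIter_fst]
    exact (Hug.norm_iter_fst_sub_le hs hδ.le _ _ _).trans
      ((mul_le_mul_of_nonneg_left hk (norm_nonneg _)).trans hτK)
  have hkI : (k : ℝ) * δ ∈ Set.Icc 0 τ := ⟨by positivity, hk⟩
  have main := hC (fun t => (x t, v t)) hzK
    (fun t ht => (hsol.deriv_x t ht).prodMk (hsol.deriv_v t ht)) δ hδ hδ1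
    (fun t ht => ⟨hΦK t ht δ (by rwa [abs_of_pos hδ]),
      hΦK t ht (-δ) (by rwa [abs_neg, abs_of_pos hδ])⟩)
    (Hug.reflectedIter f δ x₀ v₀)
    (by simp [Hug.reflectedIter, Hug.iter, hx0, hv0])
    (fun j => by
      rw [Hug.reflectedIter_two_mul_add_one, Hug.reflectedIter_two_mul, Hug.iter])
    (fun j => by
      rw [Hug.reflectedIter_two_mul_add_one, Hug.reflect_reflect hs]
      exact Hug.reflectedIter_two_mul δ x₀ v₀ (j + 1)) hZK k hk
  have hCle : C * δ ^ 2 ≤ ((1 + L) * C + 1) * δ ^ 2 := by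
    gcongr
    have : 0 ≤ L * C := by positivity
    linarith
  have hLle : L * (C * δ ^ 2) ≤ ((1 + L) * C + 1) * δ ^ 2 := by
    rw [← mul_assoc]
    gcongr
    linarith
  refine ⟨?_, ?_⟩
  · rw [← Hug.reflectedIter_fst]
    exact ((norm_fst_le _).trans main).trans hCle
  · rcases Nat.even_or_odd k with he | ho
    · rw [he.neg_one_pow, one_smul, Hug.T_apply, sub_add_cancel]
      rw [Hug.reflectedIter, if_pos he] at main
      exact ((norm_snd_le _).trans main).trans hCle
    -- For odd `k` the bound for the reflected iterates is carried back by the Lipschitz map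
    -- `reflect`, and `T v - N v = R v`.
    · have h1 := hL _ (hZK k hk) _ (hzK _ hkI)
      rw [Hug.reflectedIter, if_neg (Nat.not_even_iff_odd.2 ho)] at h1 main
      rw [Hug.reflect_reflect hs] at h1
      have h2 := (norm_snd_le _).trans (h1.trans (mul_le_mul_of_nonneg_left main hL0))
      have h3 : Hug.T f (x (k * δ)) (v (k * δ))
          + (-1 : ℝ) ^ k • Hug.N f (x (k * δ)) (v (k * δ))
          = (Hug.reflect f (x (k * δ), v (k * δ))).2 := by
        rw [ho.neg_one_pow, Hug.T_apply]
        simp only [Hug.reflect, Hug.R_apply]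
        module
      rw [h3]
      exact h2.trans hLle
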